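/- Let \(R\) be a (not necessarily commutative) ring with unit \(1\neq 0\), equipped with the discrete norm \(|0|=0\), \(|r|=1\) for \(r\ne 0\). Modules are left modules, and \(R\) is regarded as the trivial \(R\Gamma\)-module for every group \(\Gamma\). A group \(\Gamma\) is of type \(\mathrm{FP}_n(R)\) if the trivial module \(R\) has a projective \(R\Gamma\)-resolution \(P_*\to R\) with \(P_i\) finitely generated for all \(i\le n\). A free \(R\Gamma\)-module with finite basis \(B\) is a free \(R\)-module with basis \(\{\gamma b : \gamma\in\Gamma,\ b\in B\}\) and carries the norm \(\bigl\|\sum a_{\gamma b}\,\gamma b\bigr\| = \sum |a_{\gamma b}|\) (the number of nonzero coefficients). Let \(n\ge 1\) and let \(\Gamma\) be of type \(\mathrm{FP}_n(R)\). Let \(P_*\to R\) be an \((n-1)\)-admissible resolution, i.e. a projective \(R\Gamma\)-resolution of \(R\) in which \(P_{n-1}\) and \(P_n\) are finitely generated free modules with chosen finite bases. The \(n\)-th discrete homological filling function \(\mathrm{dFV}^n_{R,\Gamma}\colon\mathbb R_{\ge0}\to\mathbb R_{\ge0}\cup\{\infty\}\) (computed from \(P_*\)) is \[ \mathrm{dFV}^n_{R,\Gamma}(l)=\sup\Bigl\{\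 \inf\{\|b\| : b\in P_n,\ \partial b=c\}\ :\ c\in P_{n-1},\ \partial c=0,\ \|c\|\le l\Bigr\}, \] where for \(n=1\) the condition \(\partial c=0\) refers to the augmentation \(P_0\to R\). For functions \(f,g\colon\mathbb R_{\ge0}\to\mathbb R_{\ge0}\cup\{\infty\}\) write \(f\preccurlyeq g\) if there are constants \(C,D>0\) with \(f(v)\le C\,g(Cv+D)+Cv+D\) for all \(v\ge0\), and \(f\approx g\) if \(f\preccurlyeq g\) and \(g\preccurlyeq f\). **Theorem.** Let \(n\ge1\), and let \(G\) and \(H\) be quasi-isometric groups (finitely generated groups whose word metrics with respect to finite generating sets are quasi-isometric) of type \(\mathrm{FP}_n(R)\). Then \[ \mathrm{dFV}^n_{R,G}\approx \mathrm{dFV}^n_{R,H}, \] for every choice of \((n-1)\)-admissible resolutions used to compute the two functions. If \(n\ge2\), both functions moreover take only finite values. -/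

import Mathlib

open scoped NNReal ENNReal

universe u v v' w w'

/-! ### Word metrics and quasi-isometric groups -/

/-- The word length of `g` with respect to `S`: the least length of a word in `S ∪ S⁻¹` that
represents `g` (only used for generating sets `S`, where such a word exists). -/
noncomputable def wordLength {G : Type*} [Group G] (S : Set G) (g : G) : ℕ :=
  sInf {k : ℕ | ∃ l : List G, l.length = k ∧ (∀ s ∈ l, s ∈ S ∨ s⁻¹ ∈ S) ∧ l.prod = g}

/-- The (left invariant) word metric of `G` with respect to `S`. -/
noncomputable def wordDist {G : Type*} [Group G] (S : Set G) (g h : G) : ℝ :=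
  wordLength S (g⁻¹ * h)

/-- A map `f` between spaces with distance functions `dX` and `dY` is a quasi-isometry if it is
a quasi-isometric embedding with coarsely dense image. -/
def IsQuasiIsometry {X Y : Type*} (dX : X → X → ℝ) (dY : Y → Y → ℝ) (f : X → Y) : Prop :=
  ∃ K : ℝ, 1 ≤ K ∧
    (∀ x x', dX x x' / K - K ≤ dY (f x) (f x') ∧ dY (f x) (f x') ≤ K * dX x x' + K) ∧
    ∀ y, ∃ x, dY y (f x) ≤ K

/-- Two groups are quasi-isometric if they are finitely generated and their word metrics, with
respect to some finite generating sets, are quasi-isometric. -/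
def QuasiIsometricGroups (G : Type*) [Group G] (H : Type*) [Group H] : Prop :=
  ∃ (S : Finset G) (T : Finset H),
    Subgroup.closure (S : Set G) = ⊤ ∧ Subgroup.closure (T : Set H) = ⊤ ∧
    ∃ f : G → H, IsQuasiIsometry (wordDist (S : Set G)) (wordDist (T : Set H)) f

/-! ### Projective resolutions of the trivial module and type `FP_n` -/

/-- The augmentation `RG → R`, `∑ r_g g ↦ ∑ r_g`. -/
noncomputable def groupRingAug (R : Type*) [Ring R] (G : Type*) [Group G] :
    MonoidAlgebra R G →+* R :=
  MonoidAlgebra.liftNCRingHom (RingHom.id R) (1 : G →* R) (fun _ _ => Commute.one_right _)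

/-- A projective resolution `⋯ → X 1 → X 0 → R → 0` of the trivial (left) `RG`-module `R`.
Since `RG` acts on the trivial module `R` through the augmentation `RG → R`, an `RG`-linear map
to the trivial module is the same as a map to `R` that is semilinear along the augmentation. -/
structure TrivialResolution (R : Type u) [Ring R] (G : Type v) [Group G] where
  /-- the modules of the resolution -/
  X : ℕ → Type w
  [addCommGroup : ∀ i, AddCommGroup (X i)]
  [module : ∀ i, Module (MonoidAlgebra R G) (X i)]
  /-- the boundary maps -/
  d : ∀ i, X (i + 1) →ₗ[MonoidAlgebra R G] X i
  /-- the augmentation map onto the trivial module -/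
  aug : X 0 →ₛₗ[groupRingAug R G] R
  projective : ∀ i, Module.Projective (MonoidAlgebra R G) (X i)
  aug_surjective : Function.Surjective aug
  exact_zero : Function.Exact (d 0) aug
  exact_succ : ∀ i, Function.Exact (d (i + 1)) (d i)

attribute [instance] TrivialResolution.addCommGroup TrivialResolution.module

/-- `G` is of type `FP_n(R)`: the trivial `RG`-module `R` has a projective resolution whose modules
are finitely generated in degrees `≤ n`. -/
def IsTypeFP (R : Type u) [Ring R] (G : Type v) [Group G] (n : ℕ) : Prop :=
  ∃ P : TrivialResolution.{u, v, max u v} R G,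
    ∀ i ≤ n, Module.Finite (MonoidAlgebra R G) (P.X i)

/-! ### Norms -/

/-- The discrete norm on a ring: `|0| = 0` and `|r| = 1` for `r ≠ 0`. -/
noncomputable def discreteNorm (R : Type*) [Ring R] : RingNorm R :=
  letI := Classical.decEq R
  1

open Classical in
theorem discreteNorm_apply {R : Type*} [Ring R] (r : R) :
    discreteNorm R r = if r = 0 then 0 else 1 := by
  by_cases h : r = 0
  · simp [h]
  · simp [discreteNorm, h]

/-- The `ℓ¹`-norm on a free `RG`-module with finite basis `b`, seen as a free `R`-module with
basis `{g • b i}`: the sum of the norms of all coefficients `r_{g,i}` in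
`x = ∑ r_{g,i} g • b i`. -/
noncomputable def l1Norm {R G ι M : Type*} [Ring R] [Group G] [Fintype ι] [AddCommGroup M]
    [Module (MonoidAlgebra R G) M] (ν : RingNorm R)
    (b : Module.Basis ι (MonoidAlgebra R G) M) (x : M) : ℝ :=
  ∑ i, (b.repr x i).coeff.sum fun _ r => ν r

/-! ### Homological filling functions -/

namespace TrivialResolution

variable {R : Type u} [Ring R] {G : Type v} [Group G]

/-- The cycles of degree `k` of the augmented complex `⋯ → X 1 → X 0 → R → 0`. -/
def IsCycle (P : TrivialResolution.{u, v, w} R G) : ∀ k : ℕ, P.X k → Prop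
  | 0, c => P.aug c = 0
  | k + 1, c => P.d k c = 0

/-- The data making a resolution `k`-admissible: finite free bases in degrees `k` and `k + 1`. -/
structure Admissible (P : TrivialResolution.{u, v, w} R G) (k : ℕ) where
  /-- the rank in degree `k` -/
  rankLow : ℕ
  /-- the rank in degree `k + 1` -/
  rankHigh : ℕ
  /-- the basis in degree `k` -/
  basisLow : Module.Basis (Fin rankLow) (MonoidAlgebra R G) (P.X k)
  /-- the basis in degree `k + 1` -/
  basisHigh : Module.Basis (Fin rankHigh) (MonoidAlgebra R G) (P.X (k + 1))

namespace Admissible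

variable {P : TrivialResolution.{u, v, w} R G} {k : ℕ}

/-- The filling volume of `c`: the infimum of the norms of all `b` with `∂ b = c`. -/
noncomputable def fillVol (A : P.Admissible k) (ν : RingNorm R) (c : P.X k) : ℝ≥0∞ :=
  ⨅ (b : P.X (k + 1)) (_ : P.d k b = c), ENNReal.ofReal (l1Norm ν A.basisHigh b)

/-- The `k`-th homological filling function: the supremum of the filling volumes of all `k`-cycles
of norm at most `l`. -/
noncomputable def filling (A : P.Admissible k) (ν : RingNorm R) (l : ℝ≥0) : ℝ≥0∞ :=
  ⨆ (c : P.X k) (_ : P.IsCycle k c) (_ : l1Norm ν A.basisLow c ≤ l), A.fillVol ν c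

end Admissible

/-- The discrete homological filling function `dFV^n` computed from an `(n-1)`-admissible
resolution (for `n ≥ 1`): it measures the fillings of `(n-1)`-cycles by `n`-chains, with respect
to the discrete norm. -/
noncomputable def dFV (P : TrivialResolution.{u, v, w} R G) (n : ℕ) (A : P.Admissible (n - 1)) :
    ℝ≥0 → ℝ≥0∞ :=
  A.filling (discreteNorm R)

end TrivialResolution

/-- `f ≼ g`: there are `C, D > 0` with `f(v) ≤ C g(C v + D) + C v + D` for all `v ≥ 0`. -/
def FillingLE (f g : ℝ≥0 → ℝ≥0∞) : Prop :=
  ∃ C D : ℝ≥0, 0 < C ∧ 0 < D ∧ ∀ v : ℝ≥0, f v ≤ C * g (C * v + D) + C * v + D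

/-- `f ≈ g`: both `f ≼ g` and `g ≼ f`. -/
def FillingEquiv (f g : ℝ≥0 → ℝ≥0∞) : Prop :=
  FillingLE f g ∧ FillingLE g f

/-!
A quasi-isometry `f : G → H` of finitely generated groups has a coarse inverse, and both maps move
`g` and `g * a` to points that differ by one of finitely many elements depending only on `a`
(`QuasiIsometricGroups.exists_coarse_inverse`). Such a map induces `R`-linear, not equivariant,
chain maps between projective resolutions. The notion that makes them useful for norms is
`IsControlled`: for each `m` the elements `φ (g • m)` lie in `f g • W` for one finitely generated
`R`-submodule `W`. This refers to no bases or norms, so it makes sense for the arbitrary projective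
modules in the low degrees of a resolution.

Controlled chain maps exist, and are unique up to controlled homotopy
(`TrivialResolution.nonempty_controlledChainMap`,
`TrivialResolution.ControlledChainMap.exists_homotopy`), because controlled maps into the cycles
lift along the boundary map (`TrivialResolution.exists_controlled_lift`). Indeed, the augmented
complex is contractible over `R`, so that cycles can be filled by an `R`-linear map `h`. One
translates the value `ψ (g • m)` back by `(f g)⁻¹`, where it lies in a fixed finitely generated
submodule `W`, applies `h`, which sends `W` to a finitely generated submodule, and translates by
`f g` again.

Since the discrete norm on `R` is bounded, the `ℓ¹`-norm is bounded on each finitely generated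
`R`-submodule of a finitely generated free module. It is invariant under translations, so controlled
maps between such modules are Lipschitz (`IsControlled.exists_l1Norm_le`). Thus a cycle `c` is
filled by `ψ b + κ c`, where `b` fills the image `φ c`, the map `ψ` comes from the coarse inverse of
`f`, and `κ` is a homotopy from the identity to `ψ ∘ φ`. This compares the two filling functions
(`TrivialResolution.Admissible.fillingLE`).

In positive degrees the filling function is finite: the boundary map is an equivariant map between
projective modules, hence local, so a cycle is a sum of cycles each of which has its support in a
translate of a finite set that depends only on the size of the support. On these the map `h` above
gives fillings of bounded norm (`TrivialResolution.Admissible.exists_filling_of_card_le`). In degree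
`0` the cycles are defined by the augmentation, which is not local.
-/

/-! ### Translations and translates of finitely generated submodules -/

section Translation

variable {R G M L : Type*} [Ring R] [Group G]

/-- Multiplication by the group element `g` on an `RG`-module, as an `R`-linear map. -/
noncomputable def groupTranslate (R : Type*) [Ring R] {G M : Type*} [Group G] [AddCommGroup M]
    [Module R M] [Module (MonoidAlgebra R G) M] [IsScalarTower R (MonoidAlgebra R G) M] (g : G) :
    M →ₗ[R] M where
  toFun x := (MonoidAlgebra.single g (1 : R) : MonoidAlgebra R G) • x
  map_add' x y := smul_add _ x y
  map_smul' r x := by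
    have h (a : MonoidAlgebra R G) : r • a • x = (MonoidAlgebra.single 1 r * a) • x := by
      rw [← smul_assoc]
      congr 1
      ext; simp
    have h1 : r • x = (MonoidAlgebra.single 1 r : MonoidAlgebra R G) • x := by
      have := h 1
      rwa [one_smul, mul_one] at this
    rw [RingHom.id_apply, h, h1, smul_smul]
    simp

variable [AddCommGroup M] [Module R M] [Module (MonoidAlgebra R G) M]
  [IsScalarTower R (MonoidAlgebra R G) M]

theorem groupTranslate_apply (g : G) (x : M) :
    groupTranslate R g x = (MonoidAlgebra.single g (1 : R) : MonoidAlgebra R G) • x := rfl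

theorem single_smul_eq_smul_groupTranslate (g : G) (r : R) (x : M) :
    (MonoidAlgebra.single g r : MonoidAlgebra R G) • x = r • groupTranslate R g x := by
  rw [groupTranslate_apply, ← smul_assoc]
  simp

theorem groupTranslate_mul_apply (g h : G) (x : M) :
    groupTranslate R (g * h) x = groupTranslate R g (groupTranslate R h x) := by
  simp [groupTranslate_apply, smul_smul]

@[simp]
theorem groupTranslate_one_apply (x : M) : groupTranslate R (1 : G) x = x := by
  rw [groupTranslate_apply, ← MonoidAlgebra.one_def, one_smul]

theorem groupTranslate_groupTranslate_inv (g : G) (x : M) :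
    groupTranslate R g (groupTranslate R g⁻¹ x) = x := by
  rw [← groupTranslate_mul_apply, mul_inv_cancel, groupTranslate_one_apply]

theorem LinearMap.map_groupTranslate [AddCommGroup L] [Module R L] [Module (MonoidAlgebra R G) L]
    [IsScalarTower R (MonoidAlgebra R G) L] (d : M →ₗ[MonoidAlgebra R G] L) (g : G) (x : M) :
    d (groupTranslate R g x) = groupTranslate R g (d x) :=
  d.map_smul _ x

/-- Finitely many translates of a finitely generated submodule lie in a common finitely generated
submodule. -/
theorem exists_fg_map_groupTranslate_le {E : Set G} (hE : E.Finite) {W : Submodule R M}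
    (hW : W.FG) : ∃ V : Submodule R M, V.FG ∧ ∀ e ∈ E, W.map (groupTranslate R e) ≤ V := by
  refine ⟨⨆ e ∈ hE.toFinset, W.map (groupTranslate R e), Submodule.fg_biSup _ _ fun e _ => hW.map _,
    fun e he => ?_⟩
  exact le_biSup (fun e => W.map (groupTranslate R e)) (hE.mem_toFinset.2 he)

theorem map_groupTranslate_le_map_groupTranslate {a b : G} {W V : Submodule R M}
    (h : W.map (groupTranslate R (a⁻¹ * b)) ≤ V) :
    W.map (groupTranslate R b) ≤ V.map (groupTranslate R a) := by
  rintro _ ⟨w, hw, rfl⟩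
  refine ⟨groupTranslate R (a⁻¹ * b) w, h ⟨w, hw, rfl⟩, ?_⟩
  rw [← groupTranslate_mul_apply, mul_inv_cancel_left]

end Translation

/-! ### Coarse maps between groups -/

/-- A map between groups is bornologous if for each `a` the elements `f g` and `f (g * a)` differ by
right multiplication with one of finitely many elements, independently of `g`. For finitely
generated groups this says that `f` is coarsely Lipschitz for the word metrics. -/
def Bornologous {G H : Type*} [Group G] [Group H] (f : G → H) : Prop :=
  ∀ a, (Set.range fun g => (f g)⁻¹ * f (g * a)).Finite

/-- Two maps into a group are close if their values at the same point differ by right multiplication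
with one of finitely many elements. -/
def CloseMaps {X H : Type*} [Group H] (f f' : X → H) : Prop :=
  (Set.range fun x => (f x)⁻¹ * f' x).Finite

theorem bornologous_id {G : Type*} [Group G] : Bornologous (id : G → G) := fun a => by
  simp

theorem CloseMaps.symm {X H : Type*} [Group H] {f f' : X → H} (h : CloseMaps f f') :
    CloseMaps f' f := by
  refine (h.image fun x => x⁻¹).subset ?_
  rintro _ ⟨x, rfl⟩
  exact ⟨_, ⟨x, rfl⟩, by simp⟩

/-! ### Controlled maps -/

section Controlled

variable {R G H K M N L : Type*} [Ring R] [Group G] [Group H] [Group K]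
  [AddCommGroup M] [Module R M] [Module (MonoidAlgebra R G) M]
  [IsScalarTower R (MonoidAlgebra R G) M]
  [AddCommGroup N] [Module R N] [Module (MonoidAlgebra R H) N]
  [IsScalarTower R (MonoidAlgebra R H) N]
  [AddCommGroup L] [Module R L] [Module (MonoidAlgebra R K) L]
  [IsScalarTower R (MonoidAlgebra R K) L]

/-- An `R`-linear map `φ` from an `RG`-module to an `RH`-module is controlled by `f : G → H` if for
each `m` the elements `φ (g • m)` lie in the translates by `f g` of one finitely generated
`R`-submodule. -/
def IsControlled (f : G → H) (φ : M →ₗ[R] N) : Prop :=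
  ∀ m, ∃ W : Submodule R N, W.FG ∧ ∀ g, φ (groupTranslate R g m) ∈ W.map (groupTranslate R (f g))

theorem IsControlled.exists_of_fg {f : G → H} {φ : M →ₗ[R] N} (hφ : IsControlled f φ)
    {W : Submodule R M} (hW : W.FG) :
    ∃ V : Submodule R N, V.FG ∧
      ∀ g, ∀ w ∈ W, φ (groupTranslate R g w) ∈ V.map (groupTranslate R (f g)) := by
  refine Submodule.fg_induction (motive := fun W _ => ∃ V : Submodule R N, V.FG ∧
      ∀ g, ∀ w ∈ W, φ (groupTranslate R g w) ∈ V.map (groupTranslate R (f g))) ?_ ?_ W hW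
  · intro m
    obtain ⟨V, hV, h⟩ := hφ m
    refine ⟨V, hV, fun g w hw => ?_⟩
    obtain ⟨r, rfl⟩ := Submodule.mem_span_singleton.1 hw
    rw [map_smul, map_smul]
    exact Submodule.smul_mem _ _ (h g)
  · rintro W₁ W₂ - - ⟨V₁, hV₁, h₁⟩ ⟨V₂, hV₂, h₂⟩
    refine ⟨V₁ ⊔ V₂, hV₁.sup hV₂, fun g w hw => ?_⟩
    obtain ⟨w₁, hw₁, w₂, hw₂, rfl⟩ := Submodule.mem_sup.1 hw
    rw [map_add, map_add, Submodule.map_sup]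
    exact Submodule.add_mem_sup (h₁ g _ hw₁) (h₂ g _ hw₂)

theorem IsControlled.comp {f : G → H} {f' : H → K} {φ : M →ₗ[R] N} {ψ : N →ₗ[R] L}
    (hψ : IsControlled f' ψ) (hφ : IsControlled f φ) : IsControlled (f' ∘ f) (ψ ∘ₗ φ) := by
  intro m
  obtain ⟨W, hW, h⟩ := hφ m
  obtain ⟨V, hV, h'⟩ := hψ.exists_of_fg hW
  refine ⟨V, hV, fun g => ?_⟩
  obtain ⟨w, hw, hwg⟩ := h g
  rw [LinearMap.comp_apply, ← hwg]
  exact h' _ w hw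

theorem IsControlled.congr {f f' : G → H} {φ : M →ₗ[R] N} (hφ : IsControlled f φ)
    (hf : CloseMaps f f') : IsControlled f' φ := by
  intro m
  obtain ⟨W, hW, h⟩ := hφ m
  obtain ⟨V, hV, h'⟩ := exists_fg_map_groupTranslate_le hf.symm hW
  exact ⟨V, hV, fun g => map_groupTranslate_le_map_groupTranslate (h' _ ⟨g, rfl⟩) (h g)⟩

theorem IsControlled.sub {f : G → H} {φ ψ : M →ₗ[R] N} (hφ : IsControlled f φ)
    (hψ : IsControlled f ψ) : IsControlled f (φ - ψ) := by
  intro m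
  obtain ⟨W, hW, h⟩ := hφ m
  obtain ⟨V, hV, h'⟩ := hψ m
  refine ⟨W ⊔ V, hW.sup hV, fun g => ?_⟩
  rw [LinearMap.sub_apply, Submodule.map_sup, sub_eq_add_neg]
  exact Submodule.add_mem_sup (h g) (Submodule.neg_mem _ (h' g))

/-- Equivariant maps are controlled by the identity. -/
theorem isControlled_restrictScalars {L : Type*} [AddCommGroup L] [Module R L]
    [Module (MonoidAlgebra R G) L] [IsScalarTower R (MonoidAlgebra R G) L]
    (d : M →ₗ[MonoidAlgebra R G] L) : IsControlled (id : G → G) (d.restrictScalars R) := by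
  intro m
  refine ⟨Submodule.span R {d m}, Submodule.fg_span_singleton _, fun g => ?_⟩
  exact ⟨d m, Submodule.mem_span_singleton_self _, (d.map_groupTranslate g m).symm⟩

theorem isControlled_id : IsControlled (id : G → G) (LinearMap.id : M →ₗ[R] M) :=
  isControlled_restrictScalars (LinearMap.id : M →ₗ[MonoidAlgebra R G] M)

/-- An `R`-linear map `ψ` on a projective `RG`-module `M` lifts along `d` as soon as lifts of the
elements `ψ (g • m)` are prescribed, and the lift is assembled from finitely many prescribed values,
locally uniformly in `G`. If `M` is free, the prescribed values at its `R`-basis define the lift. In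
general `M` is a summand of the free module with basis `M`. -/
theorem exists_lift_of_values [Module.Projective (MonoidAlgebra R G) M] {B A : Type*}
    [AddCommGroup B] [Module R B] [AddCommGroup A] [Module R A] (d : B →ₗ[R] A) (ψ : M →ₗ[R] A)
    (β : G → M → B) (hβ : ∀ g m, d (β g m) = ψ (groupTranslate R g m)) :
    ∃ φ : M →ₗ[R] B, (∀ m, d (φ m) = ψ m) ∧ ∀ m, ∃ F : Finset (G × M), ∀ g,
      φ (groupTranslate R g m) ∈ Submodule.span R ((fun p : G × M => β (g * p.1) p.2) '' F) := by
  classical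
  obtain ⟨s, hs⟩ := Module.projective_def.1
    (inferInstance : Module.Projective (MonoidAlgebra R G) M)
  -- The map on the free module with basis `M` that sends `g • m` to `β g m`.
  let Φ : (M →₀ MonoidAlgebra R G) →ₗ[R] B := Finsupp.lsum ℕ fun m =>
    (Finsupp.linearCombination R fun g => β g m) ∘ₗ
      (MonoidAlgebra.coeffLinearEquiv R : MonoidAlgebra R G ≃ₗ[R] G →₀ R).toLinearMap
  have hΦ (m : M) (g : G) (r : R) :
      Φ (Finsupp.single m (MonoidAlgebra.single g r)) = r • β g m := by
    simp [Φ, MonoidAlgebra.coeffLinearEquiv]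
  have hdΦ (y : M →₀ MonoidAlgebra R G) :
      d (Φ y) = ψ (Finsupp.linearCombination (MonoidAlgebra R G) id y) := by
    induction y using Finsupp.induction_linear with
    | zero => simp
    | add y z hy hz => simp [hy, hz]
    | single m a =>
      induction a using MonoidAlgebra.induction_linear with
      | zero => simp
      | add y z hy hz =>
        rw [Finsupp.single_add]
        simp only [map_add, hy, hz]
      | single g r =>
        rw [hΦ, map_smul, hβ, Finsupp.linearCombination_single, id,
          single_smul_eq_smul_groupTranslate, map_smul]
  have hsp (y : M →₀ MonoidAlgebra R G) : ∃ F : Finset (G × M), ∀ g,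
      Φ (groupTranslate R g y) ∈ Submodule.span R ((fun p : G × M => β (g * p.1) p.2) '' F) := by
    have hadd (y z : M →₀ MonoidAlgebra R G)
        (hy : ∃ F : Finset (G × M), ∀ g,
          Φ (groupTranslate R g y) ∈ Submodule.span R ((fun p : G × M => β (g * p.1) p.2) '' F))
        (hz : ∃ F : Finset (G × M), ∀ g,
          Φ (groupTranslate R g z) ∈ Submodule.span R ((fun p : G × M => β (g * p.1) p.2) '' F)) :
        ∃ F : Finset (G × M), ∀ g, Φ (groupTranslate R g (y + z)) ∈
          Submodule.span R ((fun p : G × M => β (g * p.1) p.2) '' F) := by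
      obtain ⟨F₁, h₁⟩ := hy
      obtain ⟨F₂, h₂⟩ := hz
      refine ⟨F₁ ∪ F₂, fun g => ?_⟩
      rw [map_add, map_add, Finset.coe_union, Set.image_union, Submodule.span_union]
      exact Submodule.add_mem_sup (h₁ g) (h₂ g)
    induction y using Finsupp.induction_linear with
    | zero => exact ⟨∅, fun g => by simp⟩
    | add y z hy hz => exact hadd y z hy hz
    | single m a =>
      induction a using MonoidAlgebra.induction_linear with
      | zero => exact ⟨∅, fun g => by simp⟩
      | add y z hy hz =>
        rw [Finsupp.single_add]
        exact hadd _ _ hy hz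
      | single a r =>
        refine ⟨{(a, m)}, fun g => ?_⟩
        have : groupTranslate R g
            (Finsupp.single m (MonoidAlgebra.single a r : MonoidAlgebra R G)) =
            Finsupp.single m (MonoidAlgebra.single (g * a) r) := by
          simp [groupTranslate_apply]
        rw [this, hΦ]
        exact Submodule.smul_mem _ _ (Submodule.subset_span ⟨(a, m), by simp, rfl⟩)
  refine ⟨Φ ∘ₗ s.restrictScalars R, fun m => ?_, fun m => ?_⟩
  · rw [LinearMap.comp_apply, hdΦ, LinearMap.restrictScalars_apply, hs]
  · obtain ⟨F, hF⟩ := hsp (s m)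
    refine ⟨F, fun g => ?_⟩
    rw [LinearMap.comp_apply, LinearMap.restrictScalars_apply, s.map_groupTranslate]
    exact hF g

/-- Projective `RG`-modules have the lifting property for `R`-linear maps. -/
theorem exists_linear_lift [Module.Projective (MonoidAlgebra R G) M] {B A : Type*}
    [AddCommGroup B] [Module R B] [AddCommGroup A] [Module R A] (d : B →ₗ[R] A) (ψ : M →ₗ[R] A)
    (h : ∀ m, ∃ b, d b = ψ m) : ∃ φ : M →ₗ[R] B, ∀ m, d (φ m) = ψ m := by
  choose β hβ using h
  obtain ⟨φ, hφ, -⟩ := exists_lift_of_values d ψ (fun (g : G) m => β (groupTranslate R g m))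
    fun _ _ => hβ _
  exact ⟨φ, hφ⟩

theorem exists_controlled_lift_of_values [Module.Projective (MonoidAlgebra R G) M] {A : Type*}
    [AddCommGroup A] [Module R A] {f : G → H} (hf : Bornologous f) (d : N →ₗ[R] A)
    (ψ : M →ₗ[R] A) (β : G → M → N) (hβ : ∀ g m, d (β g m) = ψ (groupTranslate R g m))
    (hβ' : ∀ m, ∃ W : Submodule R N, W.FG ∧ ∀ g, β g m ∈ W.map (groupTranslate R (f g))) :
    ∃ φ : M →ₗ[R] N, (∀ m, d (φ m) = ψ m) ∧ IsControlled f φ := by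
  obtain ⟨φ, hφ, hF⟩ := exists_lift_of_values d ψ β hβ
  refine ⟨φ, hφ, fun m => ?_⟩
  obtain ⟨F, hF⟩ := hF m
  choose W hW hβW using hβ'
  choose V hV hWV using fun p : G × M => exists_fg_map_groupTranslate_le (hf p.1) (hW p.2)
  refine ⟨⨆ p ∈ F, V p, Submodule.fg_biSup _ _ fun p _ => hV p, fun g => ?_⟩
  refine Submodule.span_le.2 ?_ (hF g)
  rintro _ ⟨p, hp, rfl⟩
  refine Submodule.map_mono (le_biSup V hp) ?_
  exact map_groupTranslate_le_map_groupTranslate (hWV p _ ⟨g, rfl⟩) (hβW p.2 _)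

end Controlled

/-! ### Quasi-isometries as coarse maps -/

section WordMetric

variable {G : Type*} [Group G] {S : Set G}

theorem exists_word (hS : Subgroup.closure S = ⊤) (g : G) :
    ∃ l : List G, l.length = wordLength S g ∧ (∀ s ∈ l, s ∈ S ∨ s⁻¹ ∈ S) ∧ l.prod = g := by
  have hne : {k : ℕ | ∃ l : List G, l.length = k ∧ (∀ s ∈ l, s ∈ S ∨ s⁻¹ ∈ S) ∧
      l.prod = g}.Nonempty := by
    have hg : g ∈ (Subgroup.closure S).toSubmonoid := by
      rw [hS]
      exact Subgroup.mem_top g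
    rw [Subgroup.closure_toSubmonoid] at hg
    obtain ⟨l, hl, rfl⟩ := Submonoid.exists_list_of_mem_closure hg
    exact ⟨l.length, l, rfl, hl, rfl⟩
  exact Nat.sInf_mem hne

theorem wordLength_le_length {l : List G} (hl : ∀ s ∈ l, s ∈ S ∨ s⁻¹ ∈ S) :
    wordLength S l.prod ≤ l.length :=
  Nat.sInf_le ⟨l, rfl, hl, rfl⟩

theorem wordLength_mul_le (hS : Subgroup.closure S = ⊤) (g h : G) :
    wordLength S (g * h) ≤ wordLength S g + wordLength S h := by
  obtain ⟨l, hl, hlS, hlg⟩ := exists_word hS g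
  obtain ⟨m, hm, hmS, hmh⟩ := exists_word hS h
  have := wordLength_le_length (S := S) (l := l ++ m) fun s hs =>
    (List.mem_append.1 hs).elim (hlS s) (hmS s)
  rwa [List.prod_append, hlg, hmh, List.length_append, hl, hm] at this

theorem wordLength_inv_le (hS : Subgroup.closure S = ⊤) (g : G) :
    wordLength S g⁻¹ ≤ wordLength S g := by
  obtain ⟨l, hl, hlS, hlg⟩ := exists_word hS g
  have := wordLength_le_length (S := S) (l := (l.map fun x => x⁻¹).reverse) fun s hs => by
    obtain ⟨t, ht, rfl⟩ := List.mem_map.1 (List.mem_reverse.1 hs)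
    rw [inv_inv]
    exact (hlS t ht).symm
  rwa [← List.prod_inv_reverse, hlg, List.length_reverse, List.length_map, hl] at this

theorem wordDist_triangle (hS : Subgroup.closure S = ⊤) (a b c : G) :
    wordDist S a c ≤ wordDist S a b + wordDist S b c := by
  unfold wordDist
  rw [show a⁻¹ * c = (a⁻¹ * b) * (b⁻¹ * c) by group]
  exact_mod_cast wordLength_mul_le hS _ _

theorem wordDist_comm_le (hS : Subgroup.closure S = ⊤) (a b : G) :
    wordDist S a b ≤ wordDist S b a := by
  unfold wordDist
  rw [show a⁻¹ * b = (b⁻¹ * a)⁻¹ by group]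
  exact_mod_cast wordLength_inv_le hS _

theorem finite_setOf_wordLength_le (hS : Subgroup.closure S = ⊤) (hfin : S.Finite) (n : ℕ) :
    {g : G | wordLength S g ≤ n}.Finite := by
  have : Finite (S ∪ S⁻¹ : Set G) := hfin.union hfin.inv
  refine ((List.finite_length_le (S ∪ S⁻¹ : Set G) n).image
    fun l => (l.map Subtype.val).prod).subset fun g hg => ?_
  obtain ⟨l, hl, hlS, rfl⟩ := exists_word hS g
  have hlU : ∀ s ∈ l, s ∈ S ∪ S⁻¹ := hlS
  lift l to List (S ∪ S⁻¹ : Set G) using hlU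
  refine ⟨l, ?_, rfl⟩
  rw [Set.mem_ofPred_eq, ← List.length_map Subtype.val, hl]
  exact hg

/-- A family of pairs of points at bounded word distance realises only finitely many differences. -/
theorem finite_range_of_wordDist_le {X : Type*} (hS : Subgroup.closure S = ⊤) (hfin : S.Finite)
    {p q : X → G} {C : ℝ} (h : ∀ x, wordDist S (p x) (q x) ≤ C) :
    (Set.range fun x => (p x)⁻¹ * q x).Finite := by
  refine (finite_setOf_wordLength_le hS hfin ⌊C⌋₊).subset ?_
  rintro _ ⟨x, rfl⟩
  exact Nat.le_floor (h x)

theorem wordDist_mul_right (g a : G) : wordDist S g (g * a) = wordLength S a := by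
  simp [wordDist]

end WordMetric

/-- Quasi-isometric groups are coarsely equivalent. -/
theorem QuasiIsometricGroups.exists_coarse_inverse {G H : Type*} [Group G] [Group H]
    (h : QuasiIsometricGroups G H) : ∃ (f : G → H) (f' : H → G), Bornologous f ∧ Bornologous f' ∧
      CloseMaps (f' ∘ f) id ∧ CloseMaps (f ∘ f') id := by
  obtain ⟨S, T, hS, hT, f, K, hK, hf, hdense⟩ := h
  choose f' hf' using hdense
  have hK0 : 0 < K := by linarith
  have hlow (x x' : G) : wordDist (S : Set G) x x' ≤
      K * (wordDist (T : Set H) (f x) (f x') + K) := by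
    have := (hf x x').1
    rw [sub_le_iff_le_add, div_le_iff₀ hK0] at this
    linarith
  have hsymm (y : H) : wordDist (T : Set H) (f (f' y)) y ≤ K :=
    (wordDist_comm_le hT _ _).trans (hf' y)
  refine ⟨f, f', fun a => ?_, fun a => ?_, ?_, ?_⟩
  · refine finite_range_of_wordDist_le (C := K * wordLength (S : Set G) a + K) hT T.finite_toSet
      fun g => ?_
    rw [← wordDist_mul_right g a]
    exact (hf _ _).2
  · refine finite_range_of_wordDist_le (C := K * (K + wordLength (T : Set H) a + K + K)) hS
      S.finite_toSet fun y => (hlow _ _).trans ?_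
    have h1 := wordDist_triangle hT (f (f' y)) y (f (f' (y * a)))
    have h2 := wordDist_triangle hT y (y * a) (f (f' (y * a)))
    rw [wordDist_mul_right] at h2
    have := hsymm y
    have := hf' (y * a)
    gcongr
    linarith
  · exact finite_range_of_wordDist_le (C := K * (K + K)) hS S.finite_toSet fun x =>
      (hlow _ _).trans (by have := hsymm (f x); gcongr; exact this)
  · exact finite_range_of_wordDist_le hT T.finite_toSet fun y => hsymm y

/-! ### Controlled chain maps and homotopies -/

namespace TrivialResolution

variable {R : Type u} [Ring R] {G : Type v} [Group G] {H : Type v'} [Group H]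

/-- The modules of a resolution are `R`-modules through `R → RG`. -/
noncomputable instance (P : TrivialResolution.{u, v, w} R G) (i : ℕ) : Module R (P.X i) :=
  Module.compHom _ (MonoidAlgebra.singleOneRingHom : R →+* MonoidAlgebra R G)

instance (P : TrivialResolution.{u, v, w} R G) (i : ℕ) :
    IsScalarTower R (MonoidAlgebra R G) (P.X i) where
  smul_assoc r a x := by
    change (r • a) • x = (MonoidAlgebra.single 1 r : MonoidAlgebra R G) • a • x
    rw [smul_smul]
    congr 1
    ext; simp

instance (P : TrivialResolution.{u, v, w} R G) (i : ℕ) :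
    Module.Projective (MonoidAlgebra R G) (P.X i) := P.projective i

variable (P : TrivialResolution.{u, v, w} R G) (Q : TrivialResolution.{u, v', w'} R H)

theorem aug_single_smul (g : G) (r : R) (x : P.X 0) :
    P.aug ((MonoidAlgebra.single g r : MonoidAlgebra R G) • x) = r * P.aug x := by
  rw [P.aug.map_smulₛₗ]
  simp [groupRingAug]

@[simp]
theorem aug_groupTranslate (g : G) (x : P.X 0) : P.aug (groupTranslate R g x) = P.aug x := by
  rw [groupTranslate_apply, aug_single_smul, one_mul]

/-- The augmentation as an `R`-linear map. -/
noncomputable def augLinear : P.X 0 →ₗ[R] R where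
  toFun := P.aug
  map_add' := P.aug.map_add
  map_smul' r x := P.aug_single_smul 1 r x

@[simp]
theorem augLinear_apply (x : P.X 0) : P.augLinear x = P.aug x := rfl

variable {P}

theorem IsCycle.groupTranslate {i : ℕ} {c : P.X i} (hc : P.IsCycle i c) (g : G) :
    P.IsCycle i (groupTranslate R g c) := by
  cases i with
  | zero => exact (P.aug_groupTranslate g c).trans hc
  | succ i =>
    change P.d i _ = 0
    rw [LinearMap.map_groupTranslate, show P.d i c = 0 from hc, map_zero]

variable (P) in
theorem isCycle_d (i : ℕ) (x : P.X (i + 1)) : P.IsCycle i (P.d i x) := by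
  cases i with
  | zero => exact P.exact_zero.apply_apply_eq_zero x
  | succ i => exact (P.exact_succ i).apply_apply_eq_zero x

theorem IsCycle.exists_d_eq {i : ℕ} {c : P.X i} (hc : P.IsCycle i c) : ∃ b, P.d i b = c := by
  cases i with
  | zero => exact (P.exact_zero c).1 hc
  | succ i => exact (P.exact_succ i c).1 hc

variable (P) in
/-- As a complex of `R`-modules the augmented resolution is contractible. In particular, fillings of
cycles can be chosen `R`-linearly. -/
theorem exists_linear_filling (i : ℕ) :
    ∃ h : P.X i →ₗ[R] P.X (i + 1), ∀ c, P.IsCycle i c → P.d i (h c) = c := by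
  induction i with
  | zero =>
    obtain ⟨x, hx⟩ := P.aug_surjective 1
    -- The section `r ↦ r • x` of the augmentation starts the contraction.
    obtain ⟨h, hh⟩ := exists_linear_lift (G := G) ((P.d 0).restrictScalars R)
      (LinearMap.id - (LinearMap.toSpanSingleton R _ x).comp P.augLinear) fun m => by
        refine IsCycle.exists_d_eq (P := P) (i := 0) ?_
        change P.augLinear (m - P.aug m • x) = 0
        rw [map_sub, map_smul, augLinear_apply, augLinear_apply, hx, smul_eq_mul, mul_one, sub_self]
    refine ⟨h, fun c hc => ?_⟩
    have h0 : P.aug c = 0 := hc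
    simpa [h0] using hh c
  | succ i ih =>
    -- As for any contraction, `h` is chosen with `d h = id - h' d`.
    obtain ⟨h', hh'⟩ := ih
    obtain ⟨h, hh⟩ := exists_linear_lift (G := G) ((P.d (i + 1)).restrictScalars R)
      (LinearMap.id - h'.comp ((P.d i).restrictScalars R)) fun m => by
        refine IsCycle.exists_d_eq (P := P) (i := i + 1) ?_
        change P.d i (m - h' (P.d i m)) = 0
        rw [map_sub, hh' _ (P.isCycle_d i m), sub_self]
    refine ⟨h, fun c hc => ?_⟩
    have h0 : P.d i c = 0 := hc
    simpa [h0] using hh c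

/-- A controlled map into the cycles lifts to a controlled map along the boundary map. The lift of
`ψ (g • m)` is obtained by translating it back by `f g`, filling it there by means of the `R`-linear
filling map, and translating the result by `f g`. -/
theorem exists_controlled_lift {M : Type*} [AddCommGroup M] [Module R M]
    [Module (MonoidAlgebra R G) M] [IsScalarTower R (MonoidAlgebra R G) M]
    [Module.Projective (MonoidAlgebra R G) M] {f : G → H} (hf : Bornologous f) {i : ℕ}
    (ψ : M →ₗ[R] Q.X i) (hψ : IsControlled f ψ) (hc : ∀ m, Q.IsCycle i (ψ m)) :
    ∃ φ : M →ₗ[R] Q.X (i + 1), (∀ m, Q.d i (φ m) = ψ m) ∧ IsControlled f φ := by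
  obtain ⟨h, hh⟩ := Q.exists_linear_filling i
  refine exists_controlled_lift_of_values hf ((Q.d i).restrictScalars R) ψ
    (fun g m => groupTranslate R (f g) (h (groupTranslate R (f g)⁻¹ (ψ (groupTranslate R g m)))))
    (fun g m => ?_) fun m => ?_
  · rw [LinearMap.restrictScalars_apply, LinearMap.map_groupTranslate,
      hh _ ((hc _).groupTranslate _), groupTranslate_groupTranslate_inv]
  · obtain ⟨W, hW, hm⟩ := hψ m
    refine ⟨W.map h, hW.map h, fun g => ?_⟩
    obtain ⟨y, hy, hyg⟩ := hm g
    refine ⟨_, ⟨y, hy, rfl⟩, ?_⟩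
    rw [← hyg, ← groupTranslate_mul_apply, inv_mul_cancel, groupTranslate_one_apply]

variable (P)

/-- A chain map of augmented complexes of `R`-modules all of whose components are controlled by
`f`. -/
structure ControlledChainMap (f : G → H) where
  /-- the components -/
  map : ∀ i, P.X i →ₗ[R] Q.X i
  aug_map : ∀ x, Q.aug (map 0 x) = P.aug x
  d_map : ∀ i x, Q.d i (map (i + 1) x) = map i (P.d i x)
  controlled : ∀ i, IsControlled f (map i)

variable {P Q}

theorem ControlledChainMap.isCycle {f : G → H} (φ : P.ControlledChainMap Q f) {i : ℕ} {c : P.X i}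
    (hc : P.IsCycle i c) : Q.IsCycle i (φ.map i c) := by
  cases i with
  | zero => exact (φ.aug_map c).trans hc
  | succ i =>
    change Q.d i _ = 0
    rw [φ.d_map, show P.d i c = 0 from hc, map_zero]

variable (P Q)

theorem exists_controlled_map_zero {f : G → H} (hf : Bornologous f) :
    ∃ φ : P.X 0 →ₗ[R] Q.X 0, (∀ x, Q.aug (φ x) = P.aug x) ∧ IsControlled f φ := by
  obtain ⟨y, hy⟩ := Q.aug_surjective 1
  refine exists_controlled_lift_of_values hf Q.augLinear P.augLinear
    (fun g m => groupTranslate R (f g) (P.aug m • y)) (fun g m => ?_) fun m => ?_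
  · rw [augLinear_apply, aug_groupTranslate, ← augLinear_apply, map_smul, augLinear_apply, hy,
      smul_eq_mul, mul_one, augLinear_apply, aug_groupTranslate]
  · exact ⟨Submodule.span R {P.aug m • y}, Submodule.fg_span_singleton _,
      fun g => ⟨_, Submodule.mem_span_singleton_self _, rfl⟩⟩

theorem nonempty_controlledChainMap {f : G → H} (hf : Bornologous f) :
    Nonempty (P.ControlledChainMap Q f) := by
  obtain ⟨φ₀, haug, h₀⟩ := P.exists_controlled_map_zero Q hf
  have step (i : ℕ) (φ : {φ : P.X i →ₗ[R] Q.X i //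
      IsControlled f φ ∧ ∀ c, P.IsCycle i c → Q.IsCycle i (φ c)}) :
      ∃ φ' : {φ : P.X (i + 1) →ₗ[R] Q.X (i + 1) //
        IsControlled f φ ∧ ∀ c, P.IsCycle (i + 1) c → Q.IsCycle (i + 1) (φ c)},
        ∀ x, Q.d i (φ'.1 x) = φ.1 (P.d i x) := by
    obtain ⟨φ', hd, hφ'⟩ := Q.exists_controlled_lift (M := P.X (i + 1)) hf
      (φ.1 ∘ₗ (P.d i).restrictScalars R)
      (φ.2.1.comp (isControlled_restrictScalars (P.d i))) fun m => φ.2.2 _ (P.isCycle_d i m)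
    refine ⟨⟨φ', hφ', fun c hc => ?_⟩, hd⟩
    change Q.d i _ = 0
    rw [hd, LinearMap.comp_apply, LinearMap.restrictScalars_apply, show P.d i c = 0 from hc,
      map_zero]
  choose next hnext using step
  let φ : ∀ i, {φ : P.X i →ₗ[R] Q.X i //
      IsControlled f φ ∧ ∀ c, P.IsCycle i c → Q.IsCycle i (φ c)} :=
    fun i => Nat.rec ⟨φ₀, h₀, fun c hc => (haug c).trans hc⟩ next i
  exact ⟨⟨fun i => (φ i).1, haug, fun i => hnext i (φ i), fun i => (φ i).2.1⟩⟩

variable {P Q}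

/-- Two controlled chain maps agree, on cycles, up to boundaries that are given by a controlled
map. -/
theorem ControlledChainMap.exists_homotopy {f : G → H} (hf : Bornologous f)
    (φ ψ : P.ControlledChainMap Q f) (i : ℕ) :
    ∃ κ : P.X i →ₗ[R] Q.X (i + 1), IsControlled f κ ∧
      ∀ c, P.IsCycle i c → Q.d i (κ c) = φ.map i c - ψ.map i c := by
  induction i with
  | zero =>
    obtain ⟨κ, hκ, hκ'⟩ := Q.exists_controlled_lift hf (φ.map 0 - ψ.map 0)
      ((φ.controlled 0).sub (ψ.controlled 0)) fun m => by
        change Q.augLinear (φ.map 0 m - ψ.map 0 m) = 0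
        rw [map_sub, augLinear_apply, augLinear_apply, φ.aug_map, ψ.aug_map, sub_self]
    exact ⟨κ, hκ', fun c _ => hκ c⟩
  | succ i ih =>
    obtain ⟨κ', hκ', h⟩ := ih
    obtain ⟨κ, hd, hκ⟩ := Q.exists_controlled_lift (M := P.X (i + 1)) hf
      (φ.map (i + 1) - ψ.map (i + 1) - κ' ∘ₗ (P.d i).restrictScalars R)
      (((φ.controlled _).sub (ψ.controlled _)).sub
        (hκ'.comp (isControlled_restrictScalars (P.d i)))) fun m => by
        change Q.d i (φ.map (i + 1) m - ψ.map (i + 1) m - κ' (P.d i m)) = 0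
        rw [map_sub, map_sub, φ.d_map, ψ.d_map, h _ (P.isCycle_d i m), sub_self]
    refine ⟨κ, hκ, fun c hc => ?_⟩
    have h0 : P.d i c = 0 := hc
    simpa [h0] using hd c

variable (P) in
/-- The identity chain map. -/
noncomputable def ControlledChainMap.refl : P.ControlledChainMap P (id : G → G) where
  map _ := LinearMap.id
  aug_map _ := rfl
  d_map _ _ := rfl
  controlled _ := isControlled_id

/-- The composite of controlled chain maps whose underlying coarse maps compose to a map close to
`e`. -/
noncomputable def ControlledChainMap.comp {K : Type*} [Group K] {L : TrivialResolution R K}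
    {f : G → H} {f' : H → K} {e : G → K} (ψ : Q.ControlledChainMap L f')
    (φ : P.ControlledChainMap Q f) (he : CloseMaps (f' ∘ f) e) : P.ControlledChainMap L e where
  map i := ψ.map i ∘ₗ φ.map i
  aug_map x := (ψ.aug_map _).trans (φ.aug_map x)
  d_map i x := by simp only [LinearMap.comp_apply, ψ.d_map, φ.d_map]
  controlled i := ((ψ.controlled i).comp (φ.controlled i)).congr he

end TrivialResolution

/-! ### Norms of controlled maps -/

section Norm

variable {R G ι M : Type*} [Ring R] [Group G] [Fintype ι] [AddCommGroup M]
  [Module (MonoidAlgebra R G) M] (ν : RingNorm R) (b : Module.Basis ι (MonoidAlgebra R G) M)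

theorem l1Norm_nonneg (x : M) : 0 ≤ l1Norm ν b x :=
  Finset.sum_nonneg fun _ _ => Finset.sum_nonneg fun _ _ => apply_nonneg ν _

@[simp]
theorem l1Norm_zero : l1Norm ν b 0 = 0 := by
  simp [l1Norm]

theorem l1Norm_add_le (x y : M) : l1Norm ν b (x + y) ≤ l1Norm ν b x + l1Norm ν b y := by
  classical
  unfold l1Norm
  rw [← Finset.sum_add_distrib]
  refine Finset.sum_le_sum fun i _ => ?_
  rw [map_add, Finsupp.add_apply, MonoidAlgebra.coeff_add]
  set p := (b.repr x i).coeff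
  set q := (b.repr y i).coeff
  have h0 : ∀ i ∈ p.support ∪ q.support, ν 0 = 0 := fun _ _ => map_zero ν
  rw [Finsupp.sum_of_support_subset p Finset.subset_union_left _ h0,
    Finsupp.sum_of_support_subset q Finset.subset_union_right _ h0,
    Finsupp.sum_of_support_subset (p + q) Finsupp.support_add _ h0, ← Finset.sum_add_distrib]
  exact Finset.sum_le_sum fun g _ => map_add_le_add ν _ _

theorem l1Norm_sum_le {α : Type*} (s : Finset α) (x : α → M) :
    l1Norm ν b (∑ a ∈ s, x a) ≤ ∑ a ∈ s, l1Norm ν b (x a) :=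
  Finset.le_sum_of_subadditive _ (l1Norm_zero ν b).le (l1Norm_add_le ν b) _ _

variable [Module R M] [IsScalarTower R (MonoidAlgebra R G) M]

theorem l1Norm_smul_le (r : R) (x : M) : l1Norm ν b (r • x) ≤ ν r * l1Norm ν b x := by
  have hr : r • x = (MonoidAlgebra.single 1 r : MonoidAlgebra R G) • x := by
    rw [single_smul_eq_smul_groupTranslate, groupTranslate_one_apply]
  unfold l1Norm
  rw [Finset.mul_sum, hr]
  refine Finset.sum_le_sum fun i _ => ?_
  set p := (b.repr x i).coeff with hp
  have hc : (b.repr ((MonoidAlgebra.single 1 r : MonoidAlgebra R G) • x) i).coeff = r • p := by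
    ext g
    simp [hp]
  rw [hc, Finsupp.sum_of_support_subset (r • p) Finsupp.support_smul _ fun _ _ => map_zero ν,
    Finsupp.sum, Finset.mul_sum]
  exact Finset.sum_le_sum fun g _ => map_mul_le_mul ν _ _

@[simp]
theorem l1Norm_groupTranslate (g : G) (x : M) :
    l1Norm ν b (groupTranslate R g x) = l1Norm ν b x := by
  refine Finset.sum_congr rfl fun i _ => ?_
  have hc : (b.repr (groupTranslate R g x) i).coeff =
      (b.repr x i).coeff.equivMapDomain (Equiv.mulLeft g) := by
    ext h
    simp [groupTranslate_apply]
  rw [hc, Finsupp.sum_equivMapDomain]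

theorem Module.Basis.sum_coeff_smul_groupTranslate (x : M) :
    x = ∑ i, (b.repr x i).coeff.sum fun g r => r • groupTranslate R g (b i) := by
  conv_lhs => rw [← b.sum_repr x]
  refine Finset.sum_congr rfl fun i _ => ?_
  conv_lhs => rw [← MonoidAlgebra.sum_coeff_single (b.repr x i), Finsupp.sum, Finset.sum_smul]
  exact Finset.sum_congr rfl fun g _ => single_smul_eq_smul_groupTranslate _ _ _

variable {ν}

/-- If the norm of the coefficient ring is bounded, then the `ℓ¹`-norm is bounded on finitely
generated `R`-submodules. -/
theorem exists_l1Norm_le_of_fg (hν : ∀ r, ν r ≤ 1) {W : Submodule R M} (hW : W.FG) :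
    ∃ C : ℝ≥0, ∀ x ∈ W, l1Norm ν b x ≤ C := by
  refine Submodule.fg_induction (motive := fun W _ => ∃ C : ℝ≥0, ∀ x ∈ W, l1Norm ν b x ≤ C)
    ?_ ?_ W hW
  · intro m
    refine ⟨⟨l1Norm ν b m, l1Norm_nonneg ν b m⟩, fun x hx => ?_⟩
    obtain ⟨r, rfl⟩ := Submodule.mem_span_singleton.1 hx
    exact (l1Norm_smul_le ν b r m).trans (mul_le_of_le_one_left (l1Norm_nonneg ν b m) (hν r))
  · rintro W₁ W₂ - - ⟨C₁, h₁⟩ ⟨C₂, h₂⟩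
    refine ⟨C₁ + C₂, fun x hx => ?_⟩
    obtain ⟨x₁, hx₁, x₂, hx₂, rfl⟩ := Submodule.mem_sup.1 hx
    exact (l1Norm_add_le ν b _ _).trans (add_le_add (h₁ _ hx₁) (h₂ _ hx₂))

theorem IsControlled.exists_l1Norm_le {H κ N : Type*} [Group H] [Fintype κ] [AddCommGroup N]
    [Module R N] [Module (MonoidAlgebra R H) N] [IsScalarTower R (MonoidAlgebra R H) N]
    (b' : Module.Basis κ (MonoidAlgebra R H) N) (hν : ∀ r, ν r ≤ 1) {f : G → H} {φ : M →ₗ[R] N}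
    (hφ : IsControlled f φ) : ∃ C : ℝ≥0, ∀ x, l1Norm ν b' (φ x) ≤ C * l1Norm ν b x := by
  choose W hW hφW using fun i => hφ (b i)
  choose C hC using fun i => exists_l1Norm_le_of_fg b' hν (hW i)
  have hb (i : ι) (g : G) : l1Norm ν b' (φ (groupTranslate R g (b i))) ≤ ∑ j, C j := by
    obtain ⟨w, hw, hwg⟩ := hφW i g
    rw [← hwg, l1Norm_groupTranslate]
    exact (hC i w hw).trans (by
      exact_mod_cast Finset.single_le_sum (fun j _ => zero_le) (Finset.mem_univ i))
  refine ⟨∑ j, C j, fun x => ?_⟩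
  conv_lhs => rw [b.sum_coeff_smul_groupTranslate x, map_sum]
  refine (l1Norm_sum_le ν b' _ _).trans ?_
  conv_rhs => rw [l1Norm, Finset.mul_sum]
  refine Finset.sum_le_sum fun i _ => ?_
  rw [Finsupp.sum, map_sum, Finsupp.sum, Finset.mul_sum]
  refine (l1Norm_sum_le ν b' _ _).trans (Finset.sum_le_sum fun g _ => ?_)
  rw [map_smul, mul_comm]
  refine (l1Norm_smul_le ν b' _ _).trans ?_
  have := hb i g
  gcongr

end Norm

theorem discreteNorm_le_one {R : Type*} [Ring R] (r : R) : discreteNorm R r ≤ 1 := by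
  rw [discreteNorm_apply]
  split_ifs <;> norm_num

/-! ### Comparison of filling functions -/

namespace TrivialResolution

variable {R : Type u} [Ring R] {G : Type v} [Group G] {H : Type v'} [Group H]
  {P : TrivialResolution.{u, v, w} R G} {Q : TrivialResolution.{u, v', w'} R H}

/-- A cycle `c` is filled by transporting a filling of its image under a controlled chain map back
along a coarse inverse and adding the value at `c` of the homotopy to the identity. -/
theorem Admissible.fillingLE {k : ℕ} (A : P.Admissible k) (B : Q.Admissible k) {ν : RingNorm R}
    (hν : ∀ r, ν r ≤ 1) {f : G → H} {f' : H → G} (hf : Bornologous f) (hf' : Bornologous f')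
    (hff' : CloseMaps (f' ∘ f) id) : FillingLE (A.filling ν) (B.filling ν) := by
  obtain ⟨φ⟩ := P.nonempty_controlledChainMap Q hf
  obtain ⟨ψ⟩ := Q.nonempty_controlledChainMap P hf'
  obtain ⟨κ, hκ, hdκ⟩ := (ControlledChainMap.refl P).exists_homotopy bornologous_id
    (ψ.comp φ hff') k
  obtain ⟨C₁, h₁⟩ := (φ.controlled k).exists_l1Norm_le A.basisLow B.basisLow hν
  obtain ⟨C₂, h₂⟩ := (ψ.controlled (k + 1)).exists_l1Norm_le B.basisHigh A.basisHigh hν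
  obtain ⟨C₃, h₃⟩ := hκ.exists_l1Norm_le A.basisLow A.basisHigh hν
  -- The factor `C₂ + 1` is nonzero, so that multiplication by it commutes with infima in `ℝ≥0∞`.
  have hfill (c : P.X k) (hc : P.IsCycle k c) {v : ℝ≥0} (hv : l1Norm ν A.basisLow c ≤ v) :
      A.fillVol ν c ≤ (C₂ + 1 : ℝ≥0) * B.fillVol ν (φ.map k c) + (C₃ * v : ℝ≥0) := by
    have hC : ((C₂ + 1 : ℝ≥0) : ℝ≥0∞) ≠ 0 := by simp
    unfold fillVol
    rw [ENNReal.mul_iInf_of_ne hC ENNReal.coe_ne_top, ENNReal.iInf_add]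
    refine le_iInf fun y => ?_
    rw [ENNReal.mul_iInf_of_ne hC ENNReal.coe_ne_top, ENNReal.iInf_add]
    refine le_iInf fun hy => ?_
    refine (iInf₂_le (ψ.map (k + 1) y + κ c) ?_).trans ?_
    · rw [map_add, ψ.d_map, hy, hdκ c hc]
      change ψ.map k (φ.map k c) + (c - ψ.map k (φ.map k c)) = c
      abel
    · have hy0 := l1Norm_nonneg ν B.basisHigh y
      have h : l1Norm ν A.basisHigh (ψ.map (k + 1) y + κ c) ≤
          (C₂ + 1 : ℝ≥0) * l1Norm ν B.basisHigh y + (C₃ * v : ℝ≥0) := by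
        refine (l1Norm_add_le _ _ _ _).trans (add_le_add ((h₂ y).trans ?_) ((h₃ c).trans ?_))
        · gcongr
          simp
        · push_cast
          gcongr
      refine (ENNReal.ofReal_le_ofReal h).trans ?_
      rw [ENNReal.ofReal_add (by positivity) (by positivity), ENNReal.ofReal_mul (by positivity),
        ENNReal.ofReal_coe_nnreal, ENNReal.ofReal_coe_nnreal]
  refine ⟨C₁ + (C₂ + 1) + C₃, 1, by positivity, one_pos, fun v => ?_⟩
  refine iSup_le fun c => iSup_le fun hc => iSup_le fun hv => (hfill c hc hv).trans ?_
  have hB : B.fillVol ν (φ.map k c) ≤ B.filling ν ((C₁ + (C₂ + 1) + C₃) * v + 1) := by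
    refine le_iSup_of_le (φ.map k c) (le_iSup_of_le (φ.isCycle hc) (le_iSup_of_le ?_ le_rfl))
    refine (h₁ c).trans ?_
    push_cast
    have : (C₁ : ℝ) * l1Norm ν A.basisLow c ≤ C₁ * v := by gcongr
    have h2 : (0 : ℝ) ≤ (C₂ + 1 + C₃) * v := by positivity
    linarith
  have hC₂ : ((C₂ + 1 : ℝ≥0) : ℝ≥0∞) ≤ ((C₁ + (C₂ + 1) + C₃ : ℝ≥0) : ℝ≥0∞) := by
    refine ENNReal.coe_le_coe.2 ?_
    exact le_add_right (le_add_left le_rfl)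
  have hC₃ : ((C₃ * v : ℝ≥0) : ℝ≥0∞) ≤ ((C₁ + (C₂ + 1) + C₃ : ℝ≥0) : ℝ≥0∞) * v := by
    rw [← ENNReal.coe_mul]
    refine ENNReal.coe_le_coe.2 ?_
    gcongr
    exact le_add_left le_rfl
  exact (add_le_add (mul_le_mul' hC₂ hB) hC₃).trans le_self_add

end TrivialResolution

/-! ### Splitting elements with spread-out support -/

section Support

open scoped Pointwise

variable {R G ι M : Type*} [Ring R] [Group G] [Fintype ι] [AddCommGroup M]
  [Module (MonoidAlgebra R G) M] (b : Module.Basis ι (MonoidAlgebra R G) M)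

open Classical in
/-- The support in `G` of an element of a free `RG`-module with finite basis: the set of all `g` for
which some coefficient of the form `r_{g,i}` is nonzero. -/
noncomputable def groupSupport (x : M) : Finset G :=
  Finset.univ.biUnion fun i => (b.repr x i).coeff.support

variable {b}

theorem mem_groupSupport {x : M} {g : G} :
    g ∈ groupSupport b x ↔ ∃ i, (b.repr x i).coeff g ≠ 0 := by
  simp [groupSupport]

theorem groupSupport_eq_empty {x : M} : groupSupport b x = ∅ ↔ x = 0 := by
  refine ⟨fun h => b.ext_elem fun i => ?_, fun h => ?_⟩
  · ext g
    by_contra hg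
    have : g ∈ groupSupport b x := mem_groupSupport.2 ⟨i, by simpa using hg⟩
    simp [h] at this
  · ext g
    simp [mem_groupSupport, h]

theorem card_groupSupport_le_l1Norm (x : M) :
    ((groupSupport b x).card : ℝ) ≤ l1Norm (discreteNorm R) b x := by
  classical
  calc ((groupSupport b x).card : ℝ) ≤ ∑ i, ((b.repr x i).coeff.support.card : ℝ) := by
        exact_mod_cast Finset.card_biUnion_le
    _ = l1Norm (discreteNorm R) b x := by
        refine Finset.sum_congr rfl fun i _ => ?_
        rw [Finsupp.sum, Finset.card_eq_sum_ones, Nat.cast_sum]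
        refine Finset.sum_congr rfl fun g hg => ?_
        rw [discreteNorm_apply, if_neg (Finsupp.mem_support_iff.1 hg), Nat.cast_one]

/-- Two elements of the group ring with disjoint supports and sum zero vanish. -/
theorem MonoidAlgebra.eq_zero_of_add_eq_zero {x y : MonoidAlgebra R G}
    (h : Disjoint x.coeff.support y.coeff.support) (hxy : x + y = 0) : x = 0 := by
  ext g
  by_contra hg
  have hx : g ∈ x.coeff.support := Finsupp.mem_support_iff.2 hg
  have hy : y.coeff g = 0 := by
    simpa using Finset.disjoint_left.1 h hx
  have := congrArg (fun z : MonoidAlgebra R G => z.coeff g) hxy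
  simp only [MonoidAlgebra.coeff_add, Finsupp.add_apply, hy, add_zero] at this
  exact hg this

/-- An equivariant map `δ` into a projective module is local: if the support of an element `c` of
its kernel is split into two parts no elements of which differ by an element of a certain finite set
`E`, then the corresponding parts of `c` lie in the kernel, too. -/
theorem exists_finset_forall_split {L : Type*} [AddCommGroup L] [Module (MonoidAlgebra R G) L]
    [Module.Projective (MonoidAlgebra R G) L] (δ : M →ₗ[MonoidAlgebra R G] L) :
    ∃ E : Finset G, ∀ c, δ c = 0 → ∀ A : Set G,
      (∀ g ∈ groupSupport b c, g ∈ A → ∀ g' ∈ groupSupport b c, g' ∉ A → g⁻¹ * g' ∉ E) →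
      ∃ c₁ c₂, c = c₁ + c₂ ∧ δ c₁ = 0 ∧ δ c₂ = 0 ∧
        (∀ g ∈ groupSupport b c₁, g ∈ groupSupport b c ∧ g ∈ A) ∧
        ∀ g ∈ groupSupport b c₂, g ∈ groupSupport b c ∧ g ∉ A := by
  classical
  obtain ⟨s, hs⟩ := Module.projective_def.1
    (inferInstance : Module.Projective (MonoidAlgebra R G) L)
  -- `T` contains the supports of the images of the basis in the free module with basis `L`.
  let T : Finset G := Finset.univ.biUnion fun i =>
    (s (δ (b i))).support.biUnion fun m => (s (δ (b i)) m).coeff.support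
  have hT (y : M) (m : L) : (s (δ y) m).coeff.support ⊆ groupSupport b y * T := by
    have hy : s (δ y) m = ∑ i, b.repr y i * s (δ (b i)) m := by
      conv_lhs => rw [← b.sum_repr y]
      simp only [map_sum, map_smul, Finsupp.finsetSum_apply, Finsupp.smul_apply, smul_eq_mul]
    rw [hy, MonoidAlgebra.coeff_sum]
    refine Finsupp.support_finsetSum.trans (Finset.biUnion_subset.2 fun i _ => ?_)
    refine (MonoidAlgebra.support_coeff_mul_subset _ _).trans (Finset.mul_subset_mul ?_ ?_)
    · exact Finset.subset_biUnion_of_mem (fun i => (b.repr y i).coeff.support) (Finset.mem_univ i)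
    · by_cases hm : m ∈ (s (δ (b i))).support
      · exact (Finset.subset_biUnion_of_mem (fun m => (s (δ (b i)) m).coeff.support) hm).trans
          (Finset.subset_biUnion_of_mem (fun i => (s (δ (b i))).support.biUnion fun m =>
            (s (δ (b i)) m).coeff.support) (Finset.mem_univ i))
      · rw [Finsupp.notMem_support_iff.1 hm]
        simp
  -- If `g * t = g' * t'` with `t, t' ∈ T`, then `g⁻¹ * g' ∈ T * T⁻¹`. Hence the images under `δ` of
  -- the two parts of `c` have disjoint supports.
  refine ⟨T * T⁻¹, fun c hc A hA => ?_⟩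
  let part (p : G → Prop) : M := b.equivFun.symm fun i =>
    MonoidAlgebra.ofCoeff ((b.repr c i).coeff.filter p)
  have hpart (p : G → Prop) (i : ι) :
      (b.repr (part p) i).coeff = (b.repr c i).coeff.filter p := by
    rw [← b.equivFun_apply, LinearEquiv.apply_symm_apply]
  have hsupp (p : G → Prop) (g : G) (hg : g ∈ groupSupport b (part p)) :
      g ∈ groupSupport b c ∧ p g := by
    obtain ⟨i, hi⟩ := mem_groupSupport.1 hg
    rw [hpart, ← Finsupp.mem_support_iff, Finsupp.support_filter, Finset.mem_filter] at hi
    exact ⟨mem_groupSupport.2 ⟨i, Finsupp.mem_support_iff.1 hi.1⟩, hi.2⟩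
  have hsum : c = part (· ∈ A) + part (· ∉ A) := by
    refine b.ext_elem fun i => MonoidAlgebra.coeff_injective ?_
    rw [map_add, Finsupp.add_apply, MonoidAlgebra.coeff_add, hpart, hpart]
    ext g
    by_cases hg : g ∈ A <;> simp [hg]
  have hδ : δ (part (· ∈ A)) = 0 := by
    apply hs.injective
    rw [map_zero]
    ext1 m
    refine MonoidAlgebra.eq_zero_of_add_eq_zero (y := s (δ (part (· ∉ A))) m) ?_ ?_
    · refine Finset.disjoint_left.2 fun γ h₁ h₂ => ?_
      obtain ⟨g, hg, t, ht, rfl⟩ := Finset.mem_mul.1 (hT _ _ h₁)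
      obtain ⟨g', hg', t', ht', h⟩ := Finset.mem_mul.1 (hT _ _ h₂)
      obtain ⟨hgc, hgA⟩ := hsupp _ g hg
      obtain ⟨hgc', hgA'⟩ := hsupp _ g' hg'
      refine hA g hgc hgA g' hgc' hgA' ?_
      rw [show g⁻¹ * g' = t * t'⁻¹ by rw [eq_mul_inv_iff_mul_eq, mul_assoc, h]; group]
      exact Finset.mul_mem_mul ht (Finset.inv_mem_inv ht')
    · rw [← Finsupp.add_apply, ← map_add, ← map_add, ← hsum, hc, map_zero, Finsupp.zero_apply]
  refine ⟨part (· ∈ A), part (· ∉ A), hsum, hδ, ?_, hsupp _, hsupp _⟩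
  rw [hsum, map_add, hδ, zero_add] at hc
  exact hc

end Support

/-- Let `U 0 ⊆ U 1 ⊆ ⋯` be sets such that each step `U k ⊆ U (k + 1)` captures a new element of the
finite set `S` until all of `S` is captured. Then all of `S` is captured after `#S` steps. -/
theorem Finset.subset_of_forall_exists_mem_succ {α : Type*} (S : Finset α) (U : ℕ → Set α)
    (hU : Monotone U) (h : ∀ k, ¬ (S : Set α) ⊆ U k → ∃ x ∈ S, x ∈ U (k + 1) ∧ x ∉ U k) {N : ℕ}
    (hN : S.card ≤ N) : (S : Set α) ⊆ U N := by
  classical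
  have key (k : ℕ) : (S : Set α) ⊆ U k ∨ k ≤ (S.filter (· ∈ U k)).card := by
    induction k with
    | zero => exact Or.inr (Nat.zero_le _)
    | succ k ih =>
      by_cases hk : (S : Set α) ⊆ U k
      · exact Or.inl (hk.trans (hU k.le_succ))
      · obtain ⟨x, hxS, hx, hx'⟩ := h k hk
        refine Or.inr ((ih.resolve_left hk).trans_lt (Finset.card_lt_card ?_))
        refine Finset.ssubset_iff_of_subset
          (Finset.monotone_filter_right S fun y _ hy => hU k.le_succ hy) |>.2
          ⟨x, Finset.mem_filter.2 ⟨hxS, hx⟩, fun hx'' => hx' (Finset.mem_filter.1 hx'').2⟩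
  rcases key N with h | h
  · exact h
  · have : S.filter (· ∈ U N) = S :=
      Finset.eq_of_subset_of_card_le (Finset.filter_subset _ _) (hN.trans h)
    exact fun x hx => Finset.filter_eq_self.1 this x hx

/-! ### Finiteness of the filling functions -/

namespace TrivialResolution

open scoped Pointwise

variable {R : Type u} [Ring R] {G : Type v} [Group G] {P : TrivialResolution.{u, v, w} R G}

/-- Cycles whose supports lie in translates of one finite set have fillings of uniformly bounded
norm. -/
theorem Admissible.exists_filling_of_groupSupport_subset {k : ℕ} (A : P.Admissible k)
    {ν : RingNorm R} (hν : ∀ r, ν r ≤ 1) {F : Set G} (hF : F.Finite) :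
    ∃ C : ℝ≥0, ∀ c, P.IsCycle k c → ∀ g, (∀ x ∈ groupSupport A.basisLow c, g⁻¹ * x ∈ F) →
      ∃ y, P.d k y = c ∧ l1Norm ν A.basisHigh y ≤ C := by
  obtain ⟨h, hh⟩ := P.exists_linear_filling k
  let W : Submodule R (P.X k) := Submodule.span R
    ((fun p : G × Fin A.rankLow => groupTranslate R p.1 (A.basisLow p.2)) '' F ×ˢ Set.univ)
  have hW : W.FG := Submodule.fg_span ((hF.prod Set.finite_univ).image _)
  obtain ⟨C, hC⟩ := exists_l1Norm_le_of_fg A.basisHigh hν (hW.map h)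
  refine ⟨C, fun c hc g hg => ?_⟩
  have hcW : c ∈ W.map (groupTranslate R g) := by
    rw [A.basisLow.sum_coeff_smul_groupTranslate c]
    refine Submodule.sum_mem _ fun i _ => Submodule.sum_mem _ fun x hx =>
      Submodule.smul_mem _ _ ?_
    refine ⟨groupTranslate R (g⁻¹ * x) (A.basisLow i), Submodule.subset_span
      ⟨(g⁻¹ * x, i), ⟨hg x (mem_groupSupport.2 ⟨i, Finsupp.mem_support_iff.1 hx⟩), trivial⟩,
        rfl⟩, ?_⟩
    rw [← groupTranslate_mul_apply, mul_inv_cancel_left]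
  obtain ⟨z, hz, rfl⟩ := hcW
  have hzc : P.IsCycle k z := by
    have := hc.groupTranslate g⁻¹
    rwa [← groupTranslate_mul_apply, inv_mul_cancel, groupTranslate_one_apply] at this
  refine ⟨groupTranslate R g (h z), ?_, ?_⟩
  · rw [LinearMap.map_groupTranslate, hh z hzc]
  · rw [l1Norm_groupTranslate]
    exact hC _ ⟨z, hz, rfl⟩

/-- In positive degrees, cycles with bounded number of elements in the support have fillings of
uniformly bounded norm. A cycle either splits as a sum of two cycles with smaller supports or has
its support in a translate of a fixed finite set. -/
theorem Admissible.exists_filling_of_card_le {j : ℕ} (A : P.Admissible (j + 1)) {ν : RingNorm R}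
    (hν : ∀ r, ν r ≤ 1) (N : ℕ) :
    ∃ C : ℝ≥0, ∀ c, P.d j c = 0 → (groupSupport A.basisLow c).card ≤ N →
      ∃ y, P.d (j + 1) y = c ∧ l1Norm ν A.basisHigh y ≤ C := by
  classical
  obtain ⟨E, hE⟩ := exists_finset_forall_split (b := A.basisLow) (P.d j)
  induction N with
  | zero =>
    refine ⟨0, fun c _ hc => ⟨0, ?_, by simp⟩⟩
    rw [map_zero, eq_comm, ← groupSupport_eq_empty (b := A.basisLow)]
    exact Finset.card_eq_zero.1 (Nat.le_zero.1 hc)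
  | succ N ih =>
    obtain ⟨C₁, h₁⟩ := ih
    obtain ⟨C₂, h₂⟩ := A.exists_filling_of_groupSupport_subset hν
      ((insert 1 E ^ (N + 1) : Finset G).finite_toSet)
    refine ⟨C₁ + C₁ + C₂, fun c hc hcN => ?_⟩
    by_cases hc0 : c = 0
    · exact ⟨0, by rw [hc0, map_zero], by rw [l1Norm_zero]; positivity⟩
    obtain ⟨g₀, hg₀⟩ : (groupSupport A.basisLow c).Nonempty := by
      rw [Finset.nonempty_iff_ne_empty, Ne, groupSupport_eq_empty]
      exact hc0
    -- `U k` plays the role of the ball of radius `k` about `g₀`. If `U k` does not contain the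
    -- support and `U (k + 1)` captures no further point of it, the cycle can be split along `U k`.
    let U (k : ℕ) : Set G := {x | g₀⁻¹ * x ∈ (insert 1 E : Finset G) ^ k}
    have hU : Monotone U := fun k l hkl x hx =>
      Finset.pow_subset_pow_right (Finset.mem_insert_self 1 E) hkl hx
    have hg₀U (k : ℕ) : g₀ ∈ U k := hU (Nat.zero_le k) (by simp [U])
    by_cases hsplit : ∀ k, ¬ (groupSupport A.basisLow c : Set G) ⊆ U k →
        ∃ x ∈ groupSupport A.basisLow c, x ∈ U (k + 1) ∧ x ∉ U k
    · obtain ⟨y, hy, hyC⟩ := h₂ c hc g₀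
        ((groupSupport A.basisLow c).subset_of_forall_exists_mem_succ U hU hsplit hcN)
      refine ⟨y, hy, hyC.trans ?_⟩
      push_cast
      linarith [C₁.coe_nonneg]
    · push Not at hsplit
      obtain ⟨k, hk, hkU⟩ := hsplit
      obtain ⟨x₀, hx₀, hx₀U⟩ := Set.not_subset.1 hk
      obtain ⟨c₁, c₂, rfl, hc₁, hc₂, hs₁, hs₂⟩ := hE c hc (U k) fun g hg hgU g' hg' hgU' hgE => by
        refine hgU' (hkU g' hg' ?_)
        change g₀⁻¹ * g' ∈ (insert 1 E : Finset G) ^ (k + 1)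
        rw [pow_succ, show g₀⁻¹ * g' = g₀⁻¹ * g * (g⁻¹ * g') by group]
        exact Finset.mul_mem_mul hgU (Finset.mem_insert_of_mem hgE)
      have hlt₁ : (groupSupport A.basisLow c₁).card ≤ N :=
        Nat.lt_succ_iff.1 ((Finset.card_lt_card ((Finset.ssubset_iff_of_subset
          fun g hg => (hs₁ g hg).1).2 ⟨x₀, hx₀, fun h => hx₀U (hs₁ _ h).2⟩)).trans_le hcN)
      have hlt₂ : (groupSupport A.basisLow c₂).card ≤ N :=
        Nat.lt_succ_iff.1 ((Finset.card_lt_card ((Finset.ssubset_iff_of_subset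
          fun g hg => (hs₂ g hg).1).2 ⟨g₀, hg₀, fun h => (hs₂ _ h).2 (hg₀U k)⟩)).trans_le hcN)
      obtain ⟨y₁, hy₁, hyC₁⟩ := h₁ c₁ hc₁ hlt₁
      obtain ⟨y₂, hy₂, hyC₂⟩ := h₁ c₂ hc₂ hlt₂
      refine ⟨y₁ + y₂, by rw [map_add, hy₁, hy₂], (l1Norm_add_le _ _ _ _).trans ?_⟩
      push_cast
      linarith [C₂.coe_nonneg]

theorem Admissible.filling_ne_top {j : ℕ} (A : P.Admissible (j + 1)) (l : ℝ≥0) :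
    A.filling (discreteNorm R) l ≠ ∞ := by
  obtain ⟨C, hC⟩ := A.exists_filling_of_card_le (discreteNorm_le_one (R := R)) ⌊l⌋₊
  refine ne_top_of_le_ne_top (ENNReal.coe_ne_top (r := C)) ?_
  refine iSup_le fun c => iSup_le fun hc => iSup_le fun hl => ?_
  obtain ⟨y, hy, hyC⟩ := hC c hc (Nat.le_floor (by
    exact_mod_cast (card_groupSupport_le_l1Norm c).trans hl))
  refine (iInf₂_le y hy).trans ?_
  rw [← ENNReal.ofReal_coe_nnreal]
  exact ENNReal.ofReal_le_ofReal hyC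

end TrivialResolution

theorem mainTheorem1 {R : Type u} [Ring R] [Nontrivial R] {G : Type v} [Group G]
    {H : Type v'} [Group H] (n : ℕ) (hn : 1 ≤ n)
    (hG : IsTypeFP R G n) (hH : IsTypeFP R H n) (hGH : QuasiIsometricGroups G H)
    (P : TrivialResolution.{u, v, w} R G) (A : P.Admissible (n - 1))
    (Q : TrivialResolution.{u, v', w'} R H) (B : Q.Admissible (n - 1)) :
    (2 ≤ n → (∀ l, P.dFV n A l ≠ ∞) ∧ (∀ l, Q.dFV n B l ≠ ∞)) ∧
      FillingEquiv (P.dFV n A) (Q.dFV n B) := by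
  obtain ⟨f, f', hf, hf', hff', hf'f⟩ := hGH.exists_coarse_inverse
  refine ⟨fun h2 => ?_, A.fillingLE B discreteNorm_le_one hf hf' hff',
    B.fillingLE A discreteNorm_le_one hf' hf hf'f⟩
  obtain ⟨j, rfl⟩ := Nat.exists_eq_add_of_le' h2
  exact ⟨A.filling_ne_top, B.filling_ne_top⟩
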